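/- Let $E$ be a compact Polish space, and let $\mathcal K(E)$ be the space of all compact subsets of $E$ (including $\emptyset$) with the Vietoris topology. Let $I\subseteq\mathcal K(E)$ be an ideal of compact sets, i.e. a nonempty family closed under taking compact subsets and finite unions. Suppose that $I$ is a $G_\delta$ subset of $\mathcal K(E)$ and has property $(*)$: for every sequence $(K_n)_{n\in\mathbb N}$ of members of $I$ there is a $G_\delta$ set $G\subseteq E$ such that $\bigcup_n K_n\subseteq G$ and every compact subset of $G$ belongs to $I$. For $A\subseteq E$ write $A^*=\{K\in\mathcal K(E): K\cap A\neq\emptyset\}$, and say that $A^*$ is meager in $\mathcal F\subseteq\mathcal K(E)$ if $A^*\cap\mathcal F$ is a meager subset of the subspace $\mathcal F$. Then there exists a compact set $\mathcal F\subseteq\mathcal K(E)$ such that for every $G_\delta$ set $G\subseteq E$, $$G\subseteq\bigcup_{n\in\mathbb N}K_n\text{ for some sequence }(K_n)_{n\in\mathbb N}\text{ of members of }I\iff G^*\text{ is meager in }\mathcal F.$$ Further, if every member of $I$ is meager in $E$, then there exists a compact $\mathcal F$ with this same property that is also upward closed, i.e. contains every compact superset of each of its members. -/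

import Mathlib

open Set TopologicalSpace

/-- An ideal of compact sets: a nonempty family of compact subsets of `E`, closed under taking
compact subsets and finite unions. -/
structure IsCompactIdeal {E : Type*} [TopologicalSpace E] (I : Set (Compacts E)) : Prop where
  nonempty : I.Nonempty
  mem_of_subset : ∀ K ∈ I, ∀ L : Compacts E, (L : Set E) ⊆ K → L ∈ I
  sup_mem : ∀ K ∈ I, ∀ L ∈ I, K ⊔ L ∈ I

/-- Property `(*)`: for any sequence `K₀, K₁, …` in `I` there is a `G_δ` set `G` containing
all the `Kₙ`, all of whose compact subsets belong to `I`. -/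
def HasPropertyStar {E : Type*} [TopologicalSpace E] (I : Set (Compacts E)) : Prop :=
  ∀ K : ℕ → Compacts E, (∀ n, K n ∈ I) →
    ∃ G : Set E, IsGδ G ∧ (⋃ n, (K n : Set E)) ⊆ G ∧
      ∀ L : Compacts E, (L : Set E) ⊆ G → L ∈ I

/-- `A* = {K : K ∩ A ≠ ∅}`, the set of compact sets that intersect `A`. -/
def hitSet {E : Type*} [TopologicalSpace E] (A : Set E) : Set (Compacts E) :=
  {K | ((K : Set E) ∩ A).Nonempty}

/-- `𝒜` is meager in `𝓕`: `𝒜 ∩ 𝓕` is meager in the subspace topology of `𝓕`. -/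
def IsMeagerIn {X : Type*} [TopologicalSpace X] (𝒜 𝓕 : Set X) : Prop :=
  IsMeagre ((↑) ⁻¹' 𝒜 : Set 𝓕)

/-- `A` is covered by countably many members of `I`. -/
def IsCountablyCovered {E : Type*} [TopologicalSpace E] (I : Set (Compacts E)) (A : Set E) :
    Prop :=
  ∃ K : ℕ → Compacts E, (∀ n, K n ∈ I) ∧ A ⊆ ⋃ n, (K n : Set E)

/-- `𝓕` is upward closed: it contains all compact supersets of its members. -/
def IsUpwardClosed {E : Type*} [TopologicalSpace E] (𝓕 : Set (Compacts E)) : Prop :=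
  ∀ K ∈ 𝓕, ∀ L : Compacts E, (K : Set E) ⊆ L → L ∈ 𝓕

/-! Call a set small if countably many members of `I` cover it. One direction is built into the
construction: `avoidingCore I S` keeps the sets that can be approximated by members of `S` missing
any prescribed small set. By the Lindelöf property a single small set decides this, so inside the
core the sets missing a given `K ∈ I` are dense and `K*` is nowhere dense.

For the converse, property `(*)` and Baire category split the complement of `I` into countably many
avoidable families `C n`. The demand "meet every member of `C n` inside the closure of `V m`" can
thus be satisfied while missing any small set. Imposing all demands at once would be too much, so
`gated` lets a set escape the `j`-th demand by meeting the `j`-th gate, a tiny neighbourhood of a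
finite net of `T`, the closure of the points whose singletons lie in `I`. Nets are small, so sets
can be moved off them; the radii are chosen so that some then miss the whole gate. Sets missing the
gate form an open family that must obey the demand, hence meet the closure of `G ∩ V m` when that
closure lies in `C n`. A fusion of such open families against dense open sets shows that `G*` is not
meager.

If `T` itself is small, the small sets are exactly the subsets of `T`, and a family built from
disjoint cells off `T` works. If members of `I` may be nonmeager, deleting the largest small open
set reduces to the meager case. -/

section CountablyCovered

variable {E : Type*} [TopologicalSpace E] {I : Set (Compacts E)}

theorem IsCountablyCovered.mono {A B : Set E} (hB : IsCountablyCovered I B) (h : A ⊆ B) :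
    IsCountablyCovered I A :=
  let ⟨K, hK, hBK⟩ := hB
  ⟨K, hK, h.trans hBK⟩

theorem IsCountablyCovered.of_mem {K : Compacts E} (hK : K ∈ I) :
    IsCountablyCovered I (K : Set E) :=
  ⟨fun _ => K, fun _ => hK, subset_iUnion (fun _ : ℕ => (K : Set E)) 0⟩

theorem IsCountablyCovered.iUnion_nat {A : ℕ → Set E} (hA : ∀ n, IsCountablyCovered I (A n)) :
    IsCountablyCovered I (⋃ n, A n) := by
  choose K hK hAK using hA
  refine ⟨fun n => K n.unpair.1 n.unpair.2, fun n => hK _ _, iUnion_subset fun n => ?_⟩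
  refine (hAK n).trans (iUnion_subset fun m => ?_)
  refine subset_iUnion_of_subset (Nat.pair n m) ?_
  simp

theorem IsCompactIdeal.bot_mem (hI : IsCompactIdeal I) : ⊥ ∈ I :=
  let ⟨K, hK⟩ := hI.nonempty
  hI.mem_of_subset K hK ⊥ (by simp)

theorem IsCompactIdeal.isCountablyCovered_empty (hI : IsCompactIdeal I) :
    IsCountablyCovered I (∅ : Set E) := by
  simpa using IsCountablyCovered.of_mem hI.bot_mem

theorem IsCompactIdeal.isCountablyCovered_iUnion (hI : IsCompactIdeal I) {ι : Type*} [Countable ι]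
    {A : ι → Set E} (hA : ∀ i, IsCountablyCovered I (A i)) : IsCountablyCovered I (⋃ i, A i) := by
  cases isEmpty_or_nonempty ι
  · simpa using hI.isCountablyCovered_empty
  · obtain ⟨f, hf⟩ := exists_surjective_nat ι
    rw [← hf.iUnion_comp]
    exact .iUnion_nat fun n => hA _

theorem IsCompactIdeal.isCountablyCovered_biUnion (hI : IsCompactIdeal I) {ι : Type*} {s : Set ι}
    (hs : s.Countable) {A : ι → Set E} (hA : ∀ i ∈ s, IsCountablyCovered I (A i)) :
    IsCountablyCovered I (⋃ i ∈ s, A i) := by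
  have := hs.to_subtype
  rw [biUnion_eq_iUnion]
  exact hI.isCountablyCovered_iUnion fun i => hA i i.2

theorem IsCompactIdeal.isCountablyCovered_union (hI : IsCompactIdeal I) {A B : Set E}
    (hA : IsCountablyCovered I A) (hB : IsCountablyCovered I B) :
    IsCountablyCovered I (A ∪ B) := by
  rw [union_eq_iUnion]
  exact hI.isCountablyCovered_iUnion (by simp [hA, hB])

theorem IsCountablyCovered.isMeagre (hmeagre : ∀ K ∈ I, IsMeagre (K : Set E)) {A : Set E}
    (hA : IsCountablyCovered I A) : IsMeagre A := by
  obtain ⟨K, hK, hAK⟩ := hA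
  exact (isMeagre_iUnion fun n => hmeagre _ (hK n)).mono hAK

theorem IsCountablyCovered.dense_compl [BaireSpace E] (hmeagre : ∀ K ∈ I, IsMeagre (K : Set E))
    {A : Set E} (hA : IsCountablyCovered I A) : Dense Aᶜ :=
  dense_of_mem_residual (hA.isMeagre hmeagre)

end CountablyCovered

/-! ### Avoidable families and the complement of the ideal. -/

section Avoidable

variable {E : Type*} [TopologicalSpace E] {I : Set (Compacts E)}

/-- The compact sets that intersect every member of `C`. -/
def transversals (C : Set (Compacts E)) : Set (Compacts E) :=
  {D | ∀ M ∈ C, ((D : Set E) ∩ M).Nonempty}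

/-- `C` is avoidable for `I` if every countable union of members of `I` is disjoint from some
compact set that intersects every member of `C`. -/
def IsAvoidable (I C : Set (Compacts E)) : Prop :=
  ∀ A : Set E, IsCountablyCovered I A → ∃ D ∈ transversals C, Disjoint (D : Set E) A

theorem isClosed_transversals [T2Space E] (C : Set (Compacts E)) : IsClosed (transversals C) := by
  simp only [transversals, ofPred_forall]
  exact isClosed_biInter fun M _ =>
    Compacts.isClosed_inter_nonempty_of_isClosed M.isCompact.isClosed

/-- `S` is a countable union of avoidable families. -/
def IsSigmaAvoidable (I S : Set (Compacts E)) : Prop :=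
  ∃ C : ℕ → Set (Compacts E), (∀ n, IsAvoidable I (C n)) ∧ S = ⋃ n, C n

theorem IsAvoidable.mono {C C' : Set (Compacts E)} (h : IsAvoidable I C) (hC : C' ⊆ C) :
    IsAvoidable I C' := fun A hA =>
  let ⟨D, hD, hDA⟩ := h A hA
  ⟨D, fun M hM => hD M (hC hM), hDA⟩

theorem isAvoidable_empty : IsAvoidable I ∅ :=
  fun A _ => ⟨⊥, fun M hM => hM.elim, by simp⟩

theorem IsSigmaAvoidable.iUnion {ι : Type*} [Countable ι] {S : ι → Set (Compacts E)}
    (h : ∀ i, IsSigmaAvoidable I (S i)) : IsSigmaAvoidable I (⋃ i, S i) := by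
  cases isEmpty_or_nonempty ι
  · exact ⟨fun _ => ∅, fun _ => isAvoidable_empty, by simp⟩
  obtain ⟨f, hf⟩ := exists_surjective_nat ι
  choose C hC hS using h
  refine ⟨fun n => C (f n.unpair.1) n.unpair.2, fun n => hC _ _, ?_⟩
  rw [← hf.iUnion_comp]
  ext M
  simp only [hS, mem_iUnion]
  constructor
  · rintro ⟨i, j, h⟩
    exact ⟨Nat.pair i j, by simpa using h⟩
  · rintro ⟨n, h⟩
    exact ⟨_, _, h⟩

theorem IsSigmaAvoidable.mono {S S' : Set (Compacts E)} (h : IsSigmaAvoidable I S)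
    (hS : S' ⊆ S) : IsSigmaAvoidable I S' := by
  obtain ⟨C, hC, rfl⟩ := h
  exact ⟨fun n => S' ∩ C n, fun n => (hC n).mono inter_subset_right, by
    rw [← inter_iUnion, inter_eq_left.2 hS]⟩

theorem IsAvoidable.isSigmaAvoidable {C : Set (Compacts E)} (h : IsAvoidable I C) :
    IsSigmaAvoidable I C :=
  ⟨fun _ => C, fun _ => h, (iUnion_const C).symm⟩

/-- A closed family of compact sets disjoint from an ideal with property `(*)` is a countable
union of avoidable families. -/
theorem IsClosed.isSigmaAvoidable [CompactSpace E] [T2Space E] [SecondCountableTopology E]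
    (hI : IsCompactIdeal I) (hstar : HasPropertyStar I) {H : Set (Compacts E)}
    (hH : IsClosed H) (hHI : Disjoint H I) : IsSigmaAvoidable I H := by
  -- A Cantor–Bendixson type derivative: discard the basic open pieces on which `H` is already
  -- σ-avoidable, and show that the remainder `H'` is empty.
  let 𝓑 : Set (Set (Compacts E)) := {N ∈ countableBasis (Compacts E) | IsSigmaAvoidable I (N ∩ H)}
  have h𝓑 : 𝓑.Countable := (countable_countableBasis _).mono (sep_subset _ _)
  let H' := H \ ⋃₀ 𝓑
  have hsigma : IsSigmaAvoidable I (⋃ N : 𝓑, (N : Set (Compacts E)) ∩ H) := by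
    have := h𝓑.to_subtype
    exact IsSigmaAvoidable.iUnion fun N => N.2.2
  have hdiff : H ⊆ (⋃ N : 𝓑, (N : Set (Compacts E)) ∩ H) ∪ H' := by
    intro M hM
    by_cases h : M ∈ ⋃₀ 𝓑
    · obtain ⟨N, hN, hMN⟩ := h
      exact .inl (mem_iUnion.2 ⟨⟨N, hN⟩, hMN, hM⟩)
    · exact .inr ⟨hM, h⟩
  rcases H'.eq_empty_or_nonempty with hempty | hne
  · rw [hempty, union_empty] at hdiff
    exact hsigma.mono hdiff
  exfalso
  have hH' : IsClosed H' :=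
    hH.sdiff (isOpen_sUnion fun N hN => isOpen_of_mem_countableBasis hN.1)
  have hnot : ∀ N ∈ countableBasis (Compacts E), (N ∩ H').Nonempty → ¬ IsAvoidable I (N ∩ H') := by
    rintro N hN ⟨M, hMN, hM⟩ hav
    refine hM.2 ⟨N, ⟨hN, ?_⟩, hMN⟩
    have := IsSigmaAvoidable.iUnion (I := I)
      (S := fun b : Bool => cond b (N ∩ H') (⋃ N : 𝓑, (N : Set (Compacts E)) ∩ H))
      (by rintro (_ | _); exacts [hsigma, hav.isSigmaAvoidable])
    refine this.mono ?_
    rintro M ⟨hMN, hMH⟩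
    rcases hdiff hMH with h | h
    · exact mem_iUnion.2 ⟨false, h⟩
    · exact mem_iUnion.2 ⟨true, hMN, h⟩
  simp only [IsAvoidable, not_forall, not_exists, not_and] at hnot
  choose! A hA hAN using hnot
  have hcov : IsCountablyCovered I
      (⋃ N ∈ {N ∈ countableBasis (Compacts E) | (N ∩ H').Nonempty}, A N) :=
    hI.isCountablyCovered_biUnion ((countable_countableBasis _).mono (sep_subset _ _))
      fun N hN => hA N hN.1 hN.2
  obtain ⟨K, hK, hAK⟩ := hcov
  obtain ⟨G, hG, hKG, hGI⟩ := hstar K hK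
  obtain ⟨P, hP, rfl⟩ := isGδ_iff_eq_iInter_nat.1 hG
  have : CompactSpace H' := isCompact_iff_compactSpace.1 hH'.isCompact
  have : Nonempty H' := hne.to_subtype
  -- Baire category in `H'`: a member of `H'` inside every `P k` lies in `G`, hence in `I`, which is
  -- impossible.
  have hdense : Dense (⋂ k, {M : H' | ((M : Compacts E) : Set E) ⊆ P k}) := by
    refine dense_iInter_of_isOpen
      (fun k => (Compacts.isOpen_subsets_of_isOpen (hP k)).preimage continuous_subtype_val) ?_
    intro k
    rw [dense_iff_inter_open]
    rintro _ ⟨O, hO, rfl⟩ ⟨M, hM⟩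
    obtain ⟨N, hN, hMN, hNO⟩ :=
      (isBasis_countableBasis (Compacts E)).exists_subset_of_mem_open hM hO
    have hne' : (N ∩ H').Nonempty := ⟨M, hMN, M.2⟩
    -- This set misses `A N`, so it cannot be a transversal of `N ∩ H'`; a member it fails to meet
    -- lies inside `P k`.
    let D : Compacts E := ⟨(P k)ᶜ, (hP k).isClosed_compl.isCompact⟩
    have hD : Disjoint (D : Set E) (A N) := by
      refine disjoint_left.2 fun x hx hxA => hx ?_
      exact mem_iInter.1 (hKG (hAK (mem_biUnion (show N ∈ {N ∈ countableBasis (Compacts E) |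
        (N ∩ H').Nonempty} from ⟨hN, hne'⟩) hxA))) k
    have hDt : D ∉ transversals (N ∩ H') := fun h => hAN N hN hne' D h hD
    simp only [transversals, mem_ofPred_eq, not_forall] at hDt
    obtain ⟨M', hM', hdisj⟩ := hDt
    refine ⟨⟨M', hM'.2⟩, hNO hM'.1, fun x hx => ?_⟩
    by_contra hxP
    exact hdisj ⟨x, hxP, hx⟩
  obtain ⟨M, hM⟩ := hdense.nonempty
  simp only [mem_iInter, mem_ofPred_eq] at hM
  exact disjoint_left.1 hHI M.2.1 (hGI M (subset_iInter hM))

/-- The complement of a `G_δ` ideal with property `(*)` is a countable union of avoidable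
families. -/
theorem IsCompactIdeal.isSigmaAvoidable_compl [CompactSpace E] [T2Space E]
    [SecondCountableTopology E] (hI : IsCompactIdeal I) (hstar : HasPropertyStar I)
    (hGδ : IsGδ I) : IsSigmaAvoidable I Iᶜ := by
  obtain ⟨U, hU, hIU⟩ := isGδ_iff_eq_iInter_nat.1 hGδ
  have : Iᶜ = ⋃ n, (U n)ᶜ := by rw [hIU, compl_iInter]
  rw [this]
  refine .iUnion fun n => (hU n).isClosed_compl.isSigmaAvoidable hI hstar ?_
  refine disjoint_left.2 fun M hM hMI => hM ?_
  rw [hIU] at hMI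
  exact mem_iInter.1 hMI n

end Avoidable

/-! ### The core of a family, relative to small sets. -/

section Core

variable {E : Type*} [TopologicalSpace E] {I S : Set (Compacts E)}

/-- The members of the closure of `S` that can be approximated by members of `S` missing any given
countable union of members of `I`. -/
def avoidingCore (I S : Set (Compacts E)) : Set (Compacts E) :=
  ⋂ A ∈ {A : Set E | IsCountablyCovered I A}, closure {D ∈ S | Disjoint (D : Set E) A}

theorem isClosed_avoidingCore : IsClosed (avoidingCore I S) :=
  isClosed_biInter fun _ _ => isClosed_closure

theorem mem_avoidingCore_iff {D : Compacts E} :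
    D ∈ avoidingCore I S ↔
      ∀ A, IsCountablyCovered I A → D ∈ closure {D ∈ S | Disjoint (D : Set E) A} := by
  simp [avoidingCore]

theorem avoidingCore_subset (hI : IsCompactIdeal I) (hS : IsClosed S) : avoidingCore I S ⊆ S :=
  fun _ hD => hS.closure_subset_iff.2 (sep_subset _ _)
    (mem_avoidingCore_iff.1 hD ∅ hI.isCountablyCovered_empty)

/-- The complement of the core is a union of open sets indexed by small sets. Countably many indices
suffice, and the union of those small sets is the required `A`. -/
theorem exists_mem_avoidingCore_of_disjoint [SecondCountableTopology E] (hI : IsCompactIdeal I)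
    (S : Set (Compacts E)) :
    ∃ A, IsCountablyCovered I A ∧ ∀ D ∈ S, Disjoint (D : Set E) A → D ∈ avoidingCore I S := by
  let c : {A : Set E // IsCountablyCovered I A} → Set (Compacts E) :=
    fun A => (closure {D ∈ S | Disjoint (D : Set E) A})ᶜ
  obtain ⟨T, hT, hTc⟩ := isOpen_iUnion_countable c fun A => isClosed_closure.isOpen_compl
  refine ⟨⋃ A ∈ T, (A : Set E), hI.isCountablyCovered_biUnion hT fun A _ => A.2, ?_⟩
  intro D hD hdisj
  rw [mem_avoidingCore_iff]
  intro A hA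
  by_contra hcon
  have : D ∈ ⋃ i ∈ T, c i := by
    rw [hTc]
    exact mem_iUnion.2 ⟨⟨A, hA⟩, hcon⟩
  obtain ⟨B, hB, hDB⟩ := mem_iUnion₂.1 this
  exact hDB (subset_closure ⟨hD, hdisj.mono_right (subset_biUnion_of_mem (u := fun A :
    {A : Set E // IsCountablyCovered I A} => (A : Set E)) hB)⟩)

/-- The members of the core missing a given countable union of members of `I` are dense in it. -/
theorem avoidingCore_subset_closure [SecondCountableTopology E] (hI : IsCompactIdeal I)
    {A : Set E} (hA : IsCountablyCovered I A) :
    avoidingCore I S ⊆ closure {D ∈ avoidingCore I S | Disjoint (D : Set E) A} := by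
  obtain ⟨B, hB, hBS⟩ := exists_mem_avoidingCore_of_disjoint hI S
  intro D hD
  refine closure_mono ?_ (mem_avoidingCore_iff.1 hD _ (hI.isCountablyCovered_union hA hB))
  rintro D' ⟨hD'S, hD'⟩
  rw [disjoint_union_right] at hD'
  exact ⟨hBS D' hD'S hD'.2, hD'.1⟩

/-- Small sets have dense complement, so a larger `D₁` is a limit of finite sets missing `A`. Their
unions with approximations of `D` stay in `S`, miss `A` and converge to `D ⊔ D₁ = D₁`. -/
theorem IsUpwardClosed.avoidingCore [BaireSpace E] (hmeagre : ∀ K ∈ I, IsMeagre (K : Set E))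
    (hS : IsUpwardClosed S) : IsUpwardClosed (avoidingCore I S) := by
  intro D hD D₁ hDD₁
  rw [mem_avoidingCore_iff] at hD ⊢
  intro A hA
  have hD₁ : D₁ ∈ closure {K : Compacts E | (K : Set E).Finite ∧ (K : Set E) ⊆ Aᶜ} := by
    rw [Compacts.closure_finite_subsets, (hA.dense_compl hmeagre).closure_eq]
    exact subset_univ (D₁ : Set E)
  have hsup : D ⊔ D₁ = D₁ := sup_eq_right.2 hDD₁
  rw [← hsup]
  refine map_mem_closure₂ continuous_sup (hD A hA) hD₁ ?_
  rintro a ⟨haS, ha⟩ b ⟨-, hb⟩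
  refine ⟨hS a haS _ (by simp), ?_⟩
  rw [Compacts.coe_sup, disjoint_union_left]
  exact ⟨ha, subset_compl_iff_disjoint_right.1 hb⟩

end Core

/-! ### Closeness in the Hausdorff metric. -/

section HausdorffClose

variable {E : Type*} [MetricSpace E]

/-- Each point of one of the sets is at distance less than `δ` from the other set. -/
def HausdorffClose (δ : ℝ) (s t : Set E) : Prop :=
  (∀ x ∈ s, ∃ y ∈ t, dist x y < δ) ∧ ∀ y ∈ t, ∃ x ∈ s, dist y x < δ

theorem HausdorffClose.trans {δ ε : ℝ} {s t u : Set E} (h : HausdorffClose δ s t)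
    (h' : HausdorffClose ε t u) : HausdorffClose (δ + ε) s u := by
  constructor
  · intro x hx
    obtain ⟨y, hy, hxy⟩ := h.1 x hx
    obtain ⟨z, hz, hyz⟩ := h'.1 y hy
    exact ⟨z, hz, (dist_triangle x y z).trans_lt (add_lt_add hxy hyz)⟩
  · intro z hz
    obtain ⟨y, hy, hyz⟩ := h'.2 z hz
    obtain ⟨x, hx, hxy⟩ := h.2 y hy
    exact ⟨x, hx, (dist_triangle z y x).trans_lt (by linarith)⟩

theorem HausdorffClose.mono {δ ε : ℝ} {s t : Set E} (h : HausdorffClose δ s t) (hδ : δ ≤ ε) :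
    HausdorffClose ε s t :=
  ⟨fun x hx => let ⟨y, hy, h⟩ := h.1 x hx; ⟨y, hy, h.trans_le hδ⟩,
    fun x hx => let ⟨y, hy, h⟩ := h.2 x hx; ⟨y, hy, h.trans_le hδ⟩⟩

theorem HausdorffClose.refl {δ : ℝ} (hδ : 0 < δ) (s : Set E) : HausdorffClose δ s s :=
  ⟨fun x hx => ⟨x, hx, by simpa⟩, fun x hx => ⟨x, hx, by simpa⟩⟩

/-- Adding points close to `t` preserves closeness. -/
theorem HausdorffClose.union_left {δ : ℝ} {s t u : Set E} (h : HausdorffClose δ s t)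
    (hu : ∀ x ∈ u, ∃ y ∈ t, dist x y < δ) : HausdorffClose δ (s ∪ u) t :=
  ⟨fun x hx => hx.elim (h.1 x) (hu x),
    fun y hy => let ⟨x, hx, h⟩ := h.2 y hy; ⟨x, .inl hx, h⟩⟩

theorem exists_hausdorffClose_of_mem_nhds {D : Compacts E} {N : Set (Compacts E)}
    (hN : N ∈ nhds D) :
    ∃ δ > 0, ∀ D' : Compacts E, HausdorffClose δ (D' : Set E) D → D' ∈ N := by
  obtain ⟨ε, hε, hεN⟩ := EMetric.mem_nhds_iff.1 hN
  obtain ⟨δ, hδ, hδε⟩ := ENNReal.lt_iff_exists_nnreal_btwn.1 hε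
  have hδ' : 0 < δ := by exact_mod_cast hδ
  refine ⟨δ, hδ', fun D' hD' => hεN ?_⟩
  rw [Metric.mem_eball, Compacts.edist_eq]
  refine lt_of_le_of_lt ?_ hδε
  refine Metric.hausdorffEDist_le_of_mem_edist (fun x hx => ?_) fun x hx => ?_
  · obtain ⟨y, hy, h⟩ := hD'.1 x hx
    refine ⟨y, hy, ?_⟩
    rw [edist_nndist]
    exact_mod_cast h.le
  · obtain ⟨y, hy, h⟩ := hD'.2 x hx
    refine ⟨y, hy, ?_⟩
    rw [edist_nndist]
    exact_mod_cast h.le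

theorem hausdorffClose_mem_nhds (D : Compacts E) {δ : ℝ} (hδ : 0 < δ) :
    {D' : Compacts E | HausdorffClose δ (D' : Set E) D} ∈ nhds D := by
  refine Filter.mem_of_superset (Metric.eball_mem_nhds D (ENNReal.ofReal_pos.2 hδ)) ?_
  intro D' hD'
  rw [Metric.mem_eball, Compacts.edist_eq] at hD'
  constructor
  · intro x hx
    obtain ⟨y, hy, h⟩ := Metric.exists_edist_lt_of_hausdorffEDist_lt hx hD'
    exact ⟨y, hy, by rwa [edist_lt_ofReal] at h⟩
  · intro x hx
    rw [Metric.hausdorffEDist_comm] at hD'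
    obtain ⟨y, hy, h⟩ := Metric.exists_edist_lt_of_hausdorffEDist_lt hx hD'
    exact ⟨y, hy, by rwa [edist_lt_ofReal] at h⟩

end HausdorffClose

/-! ### Gates, demands and the choice of radii. -/

section Gates

variable {E : Type*} [MetricSpace E]

/-- The compact sets that intersect `T` and satisfy the constraints `𝒟 i` for `i ∈ s`. -/
def constrained (T : Set E) (𝒟 : ℕ → Set (Compacts E)) (s : Finset ℕ) : Set (Compacts E) :=
  {D | ((D : Set E) ∩ T).Nonempty ∧ ∀ i ∈ s, D ∈ 𝒟 i}

/-- The neighbourhood of radius `r (j + 1)` of the net of mesh `r j`. -/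
def gate (net : ℝ → Set E) (r : ℕ → ℝ) (j : ℕ) : Set E :=
  Metric.thickening (r (j + 1)) (net (r j))

/-- The compact sets that intersect `T` and, for every `j`, intersect the closure of the `j`-th
gate or satisfy the `j`-th constraint. -/
def gated (T : Set E) (𝒟 : ℕ → Set (Compacts E)) (net : ℝ → Set E) (r : ℕ → ℝ) :
    Set (Compacts E) :=
  {D | ((D : Set E) ∩ T).Nonempty ∧
    ∀ j, ((D : Set E) ∩ closure (gate net r j)).Nonempty ∨ D ∈ 𝒟 j}

/-- `D` satisfies, robustly, the constraints in `s` together with the `j`-th one, and it intersects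
the earlier gates whose index is not in `s`. -/
structure IsStageWitness (I : Set (Compacts E)) (T : Set E) (𝒟 : ℕ → Set (Compacts E))
    (net : ℝ → Set E) (r : ℕ → ℝ) (j : ℕ) (s : Finset ℕ) (D : Compacts E) : Prop where
  mem : D ∈ avoidingCore I (constrained T 𝒟 (insert j s))
  hits : ∀ i < j, i ∉ s → ((D : Set E) ∩ gate net r i).Nonempty

/-- If some witness in `𝒩 j` misses the net of mesh `r j`, then some witness in `𝒩 j` misses its
neighbourhood of radius `3 * r (j + 1)`. -/
def IsAdapted (I : Set (Compacts E)) (T : Set E) (𝒟 𝒩 : ℕ → Set (Compacts E))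
    (net : ℝ → Set E) (r : ℕ → ℝ) (j : ℕ) : Prop :=
  (∃ s, ∃ D ∈ 𝒩 j, IsStageWitness I T 𝒟 net r j s D ∧ Disjoint (D : Set E) (net (r j))) →
    ∃ s, ∃ D ∈ 𝒩 j, IsStageWitness I T 𝒟 net r j s D ∧
      Disjoint (D : Set E) (Metric.thickening (3 * r (j + 1)) (net (r j)))

variable {I : Set (Compacts E)} {T : Set E} {𝒟 𝒩 : ℕ → Set (Compacts E)} {net : ℝ → Set E}
  {r : ℕ → ℝ} {j : ℕ}

theorem gate_congr {r' : ℕ → ℝ} (h : ∀ i ≤ j + 1, r i = r' i) : gate net r j = gate net r' j := by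
  rw [gate, gate, h _ le_rfl, h _ j.le_succ]

theorem IsStageWitness.congr {r' : ℕ → ℝ} (h : ∀ i ≤ j, r i = r' i) {s : Finset ℕ}
    {D : Compacts E} (hD : IsStageWitness I T 𝒟 net r j s D) :
    IsStageWitness I T 𝒟 net r' j s D where
  mem := hD.mem
  hits i hi his := by
    rw [← gate_congr (r := r) fun k hk => h k (by omega)]
    exact hD.hits i hi his

theorem IsAdapted.congr {r' : ℕ → ℝ} (h : ∀ i ≤ j + 1, r i = r' i)
    (hr : IsAdapted I T 𝒟 𝒩 net r j) : IsAdapted I T 𝒟 𝒩 net r' j := by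
  rintro ⟨s, D, hDN, hD, hdisj⟩
  obtain ⟨s', D', hDN', hD', hdisj'⟩ :=
    hr ⟨s, D, hDN, hD.congr fun i hi => (h i (by omega)).symm, by rwa [h _ j.le_succ]⟩
  exact ⟨s', D', hDN', hD'.congr fun i hi => h i (by omega), by
    rwa [h _ le_rfl, h _ j.le_succ] at hdisj'⟩

/-- A witness and the net it misses are disjoint compact sets, hence a positive distance apart, and
a third of such a distance can serve as the next radius. Changing `r (j + 1)` does not affect
witnesses at stage `j`, which involve only the radii up to `r j`. -/
theorem exists_isAdapted_update (hnet : ∀ ε > 0, IsCompact (net ε)) (r : ℕ → ℝ) (j : ℕ)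
    (hr : 0 < r j) :
    ∃ x, 0 < x ∧ x ≤ r j / 2 ∧ IsAdapted I T 𝒟 𝒩 net (Function.update r (j + 1) x) j := by
  by_cases hex : ∃ s, ∃ D ∈ 𝒩 j, IsStageWitness I T 𝒟 net r j s D ∧
      Disjoint (D : Set E) (net (r j))
  · obtain ⟨s, D, hDN, hD, hdisj⟩ := hex
    obtain ⟨δ, hδ, hδD⟩ := hdisj.symm.exists_thickenings (hnet _ hr) D.isCompact.isClosed
    have hdisj' : Disjoint (D : Set E) (Metric.thickening δ (net (r j))) :=
      (hδD.mono_right (Metric.self_subset_thickening hδ _)).symm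
    have hx : 0 < min (δ / 3) (r j / 2) := lt_min (by positivity) (by positivity)
    refine ⟨min (δ / 3) (r j / 2), hx, min_le_right _ _, fun _ => ⟨s, D, hDN, ?_, ?_⟩⟩
    · refine hD.congr fun i hi => ?_
      rw [Function.update_of_ne (by omega)]
    · rw [Function.update_self, Function.update_of_ne (by omega)]
      refine hdisj'.mono_right (Metric.thickening_mono ?_ _)
      linarith [min_le_left (δ / 3) (r j / 2)]
  · refine ⟨r j / 2, by positivity, le_rfl, fun ⟨s, D, hDN, hD, hdisj⟩ => (hex ?_).elim⟩
    refine ⟨s, D, hDN, hD.congr fun i hi => ?_, ?_⟩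
    · rw [Function.update_of_ne (by omega)]
    · rwa [Function.update_of_ne (by omega)] at hdisj

theorem exists_adapted_radii (I : Set (Compacts E)) (T : Set E) (𝒟 𝒩 : ℕ → Set (Compacts E))
    (hnet : ∀ ε > 0, IsCompact (net ε)) :
    ∃ r : ℕ → ℝ, (∀ j, 0 < r j) ∧ (∀ j, r (j + 1) ≤ r j / 2) ∧
      ∀ j, IsAdapted I T 𝒟 𝒩 net r j := by
  choose! φ hφ0 hφ1 hφ2 using
    fun r j => exists_isAdapted_update (I := I) (T := T) (𝒟 := 𝒟) (𝒩 := 𝒩) hnet r j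
  let R : ℕ → ℕ → ℝ := fun n => Nat.rec (fun _ => 1)
    (fun j r => Function.update r (j + 1) (φ r j)) n
  have hR : ∀ j, R (j + 1) = Function.update (R j) (j + 1) (φ (R j) j) := fun _ => rfl
  have hagree : ∀ j i, i ≤ j → R j i = R i i := by
    intro j i hij
    induction j, hij using Nat.le_induction with
    | base => rfl
    | succ j hij ih => rw [hR, Function.update_of_ne (by omega), ih]
  have hsucc : ∀ j, R (j + 1) (j + 1) = φ (R j) j := fun j => by rw [hR, Function.update_self]
  have hpos : ∀ j, 0 < R j j := by
    intro j
    induction j with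
    | zero => exact one_pos
    | succ j ih => rw [hsucc]; exact hφ0 _ _ ih
  refine ⟨fun j => R j j, hpos, fun j => ?_, fun j => ?_⟩
  · simp only [hsucc]
    exact hφ1 _ _ (hpos j)
  · refine IsAdapted.congr (r := R (j + 1)) (fun i hi => hagree _ _ hi) ?_
    rw [hR]
    exact hφ2 _ _ (hpos j)

end Gates

/-! ### Closure properties of the gated family. -/

section UpwardClosed

variable {E : Type*} [MetricSpace E] {T : Set E} {𝒟 : ℕ → Set (Compacts E)} {net : ℝ → Set E}
  {r : ℕ → ℝ}

theorem isClosed_gated (hT : IsClosed T) (h𝒟 : ∀ j, IsClosed (𝒟 j)) :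
    IsClosed (gated T 𝒟 net r) := by
  simp only [gated, ofPred_and, ofPred_forall, ofPred_or]
  exact (Compacts.isClosed_inter_nonempty_of_isClosed hT).inter (isClosed_iInter fun j =>
    (Compacts.isClosed_inter_nonempty_of_isClosed isClosed_closure).union (h𝒟 j))

theorem isUpwardClosed_gated (h𝒟 : ∀ j, IsUpwardClosed (𝒟 j)) :
    IsUpwardClosed (gated T 𝒟 net r) := fun D hD D' hDD' =>
  ⟨hD.1.mono (inter_subset_inter_left _ hDD'), fun j =>
    (hD.2 j).imp (fun h => h.mono (inter_subset_inter_left _ hDD')) fun h => h𝒟 j D h D' hDD'⟩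

end UpwardClosed

/-- The hypotheses under which the gated family represents the ideal `I`. -/
structure IsGateSystem {E : Type*} [MetricSpace E] (I : Set (Compacts E)) (T : Set E)
    (𝒟 𝒩 : ℕ → Set (Compacts E)) (net : ℝ → Set E) (r : ℕ → ℝ) : Prop where
  ideal : IsCompactIdeal I
  meagre : ∀ K ∈ I, IsMeagre (K : Set E)
  exists_notMem : ∀ A, IsCountablyCovered I A → ∃ x ∈ T, x ∉ A
  isClosed_constraint : ∀ j, IsClosed (𝒟 j)
  isUpwardClosed_constraint : ∀ j, IsUpwardClosed (𝒟 j)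
  net_covered : ∀ ε > 0, IsCountablyCovered I (net ε)
  net_dense : ∀ ε > 0, ∀ x ∈ T, ∃ a ∈ net ε, dist x a < ε
  pos : ∀ j, 0 < r j
  halve : ∀ j, r (j + 1) ≤ r j / 2
  adapted : ∀ j, IsAdapted I T 𝒟 𝒩 net r j

/-! ### Approximation inside the core of the gated family. -/

namespace IsGateSystem

variable {E : Type*} [MetricSpace E] {I : Set (Compacts E)} {T : Set E}
  {𝒟 𝒩 : ℕ → Set (Compacts E)} {net : ℝ → Set E} {r : ℕ → ℝ}

theorem antitone (h : IsGateSystem I T 𝒟 𝒩 net r) : Antitone r :=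
  antitone_nat_of_succ_le fun j => by linarith [h.halve j, h.pos j]

theorem tendsto (h : IsGateSystem I T 𝒟 𝒩 net r) :
    Filter.Tendsto r Filter.atTop (nhds 0) := by
  have hle : ∀ j, r j ≤ r 0 * (1 / 2) ^ j := by
    intro j
    induction j with
    | zero => simp
    | succ j ih => rw [pow_succ]; linarith [h.halve j]
  have hlim : Filter.Tendsto (fun j : ℕ => r 0 * (1 / 2 : ℝ) ^ j) Filter.atTop (nhds 0) := by
    simpa using (tendsto_pow_atTop_nhds_zero_of_lt_one (by norm_num : (0 : ℝ) ≤ 1 / 2)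
      (by norm_num)).const_mul (r 0)
  exact squeeze_zero (fun j => (h.pos j).le) hle hlim

variable [CompactSpace E]

/-- A compact set that robustly satisfies finitely many constraints and intersects the other gates
below `j` is close to a member of the core of the gated family. -/
theorem exists_mem_core_gated (h : IsGateSystem I T 𝒟 𝒩 net r) {j : ℕ} {s : Finset ℕ}
    {D : Compacts E} (hD : D ∈ avoidingCore I (constrained T 𝒟 s))
    (hgate : ∀ i < j, i ∉ s → ((D : Set E) ∩ gate net r i).Nonempty) {δ : ℝ} (hδ : 0 < δ) :
    ∃ D' ∈ avoidingCore I (gated T 𝒟 net r), HausdorffClose (r j + δ) (D' : Set E) D := by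
  obtain ⟨A, hA, hAcore⟩ := exists_mem_avoidingCore_of_disjoint h.ideal (gated T 𝒟 net r)
  have hopen : ∀ i, IsOpen (gate net r i) := fun i => Metric.isOpen_thickening
  have hN : {D' : Compacts E | HausdorffClose δ (D' : Set E) D} ∩
      ⋂ i ∈ {i ∈ Finset.range j | i ∉ s}, {D' : Compacts E | ((D' : Set E) ∩ gate net r i).Nonempty}
      ∈ nhds D := by
    refine Filter.inter_mem (hausdorffClose_mem_nhds D hδ) ?_
    rw [Filter.biInter_finset_mem]
    intro i hi
    simp only [Finset.mem_filter, Finset.mem_range] at hi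
    exact (Compacts.isOpen_inter_nonempty_of_isOpen (hopen i)).mem_nhds (hgate i hi.1 hi.2)
  obtain ⟨D₁, ⟨hD₁D, hD₁gate⟩, hD₁, hD₁A⟩ :=
    mem_closure_iff_nhds.1 (mem_avoidingCore_iff.1 hD A hA) _ hN
  obtain ⟨p, hpD, hpT⟩ := hD₁.1
  -- The net has a point within `r i` of `p`, and the open gate around it contains points off the
  -- meager set `A`.
  have hpt : ∀ i, ∃ q ∈ gate net r i, q ∉ A ∧ dist q p < r i := by
    intro i
    obtain ⟨a, ha, hpa⟩ := h.net_dense _ (h.pos i) p hpT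
    obtain ⟨q, ⟨hq₁, hq₂⟩, hqA⟩ := (hA.dense_compl h.meagre).inter_open_nonempty
      (gate net r i ∩ Metric.ball p (r i)) ((hopen i).inter Metric.isOpen_ball)
      ⟨a, Metric.self_subset_thickening (h.pos _) _ ha, by rwa [Metric.mem_ball, dist_comm]⟩
    exact ⟨q, hq₁, hqA, hq₂⟩
  choose q hqgate hqA hqp using hpt
  have hqlim : Filter.Tendsto (fun i => q (i + j)) Filter.atTop (nhds p) := by
    rw [tendsto_iff_dist_tendsto_zero]
    exact squeeze_zero (fun _ => dist_nonneg) (fun i => (hqp (i + j)).le)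
      (h.tendsto.comp (Filter.tendsto_add_atTop_nat j))
  -- One point in each gate of index at least `j`. They converge to `p`, so adding them all keeps
  -- the set compact and moves it by less than `r j`. This is why members must meet `T`.
  let Q : Compacts E := ⟨insert p (range fun i => q (i + j)), hqlim.isCompact_insert_range⟩
  have hQ : ∀ x ∈ (Q : Set E), x ∉ A ∧ dist x p < r j := by
    rintro x (rfl | ⟨i, rfl⟩)
    · exact ⟨disjoint_left.1 hD₁A hpD, by simpa using h.pos j⟩
    · exact ⟨hqA _, (hqp _).trans_le (h.antitone (Nat.le_add_left _ _))⟩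
  have hQD₁ : HausdorffClose (r j) (D₁ ∪ Q : Set E) D₁ :=
    (HausdorffClose.refl (h.pos j) _).union_left fun x hx => ⟨p, hpD, (hQ x hx).2⟩
  refine ⟨D₁ ⊔ Q, hAcore _ ⟨⟨p, .inl hpD, hpT⟩, fun i => ?_⟩ ?_, ?_⟩
  · by_cases his : i ∈ s
    · exact .inr (h.isUpwardClosed_constraint i D₁ (hD₁.2 i his) _ subset_union_left)
    · left
      by_cases hij : i < j
      · have := mem_iInter₂.1 hD₁gate i (by simp [hij, his])
        exact this.mono (inter_subset_inter subset_union_left subset_closure)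
      · refine ⟨q i, .inr (.inr ⟨i - j, ?_⟩), subset_closure (hqgate i)⟩
        simp only
        congr 1
        omega
  · rw [Compacts.coe_sup, disjoint_union_left]
    exact ⟨hD₁A, disjoint_left.2 fun x hx => (hQ x hx).1⟩
  · exact hQD₁.trans hD₁D

/-- A singleton at a point of `T` outside a suitable small set starts the construction; this is
where `T` must not be small. -/
theorem core_gated_nonempty (h : IsGateSystem I T 𝒟 𝒩 net r) :
    (avoidingCore I (gated T 𝒟 net r)).Nonempty := by
  obtain ⟨A, hA, hAcore⟩ := exists_mem_avoidingCore_of_disjoint h.ideal (constrained T 𝒟 ∅)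
  obtain ⟨x, hxT, hxA⟩ := h.exists_notMem A hA
  have hx : ({x} : Compacts E) ∈ avoidingCore I (constrained T 𝒟 ∅) :=
    hAcore _ ⟨⟨x, rfl, hxT⟩, by simp⟩ (by
      rw [Compacts.coe_singleton]; exact disjoint_singleton_left.2 hxA)
  obtain ⟨D, hD, -⟩ := h.exists_mem_core_gated (j := 0) hx (by simp) one_pos
  exact ⟨D, hD⟩

/-- Near each member of the core of the gated family that contains `Y` there is one that misses
the closure of the `j`-th gate, if the `j`-th constraint can be satisfied inside `Y`, avoiding any
countable union of members of `I`. -/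
theorem exists_mem_core_gated_disjoint (h : IsGateSystem I T 𝒟 𝒩 net r) {D : Compacts E}
    (hD : D ∈ avoidingCore I (gated T 𝒟 net r)) {Y : Set E} (hYD : Y ⊆ D) {j : ℕ}
    (hj : ∀ A, IsCountablyCovered I A → ∃ D' ∈ 𝒟 j, Disjoint (D' : Set E) A ∧ (D' : Set E) ⊆ Y)
    (hNo : IsOpen (𝒩 j)) (hDN : D ∈ 𝒩 j) {δ : ℝ}
    (hN : ∀ D' ∈ 𝒩 j, HausdorffClose δ (D' : Set E) D) :
    ∃ D' ∈ avoidingCore I (gated T 𝒟 net r),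
      HausdorffClose (2 * r (j + 1) + δ) (D' : Set E) D ∧
        Disjoint (D' : Set E) (closure (gate net r j)) := by
  classical
  have hopen : ∀ i, IsOpen (gate net r i) := fun i => Metric.isOpen_thickening
  -- The earlier gates whose closures `D` misses. Nearby gated sets miss them too, and so must obey
  -- the corresponding demands.
  let s : Finset ℕ := {i ∈ Finset.range j | Disjoint (D : Set E) (closure (gate net r i))}
  obtain ⟨B, hB, hBcore⟩ :=
    exists_mem_avoidingCore_of_disjoint h.ideal (constrained T 𝒟 (insert j s))
  let A := B ∪ net (r j)
  have hA : IsCountablyCovered I A := h.ideal.isCountablyCovered_union hB (h.net_covered _ (h.pos j))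
  obtain ⟨η, hη, hηN⟩ := exists_hausdorffClose_of_mem_nhds (hNo.mem_nhds hDN)
  have hnhds : {D' : Compacts E | HausdorffClose η (D' : Set E) D} ∩
      ⋂ i ∈ s, {D' : Compacts E | (D' : Set E) ⊆ (closure (gate net r i))ᶜ} ∈ nhds D := by
    refine Filter.inter_mem (hausdorffClose_mem_nhds D hη) ?_
    rw [Filter.biInter_finset_mem]
    intro i hi
    simp only [s, Finset.mem_filter, Finset.mem_range] at hi
    exact (Compacts.isOpen_subsets_of_isOpen isClosed_closure.isOpen_compl).mem_nhds
      (subset_compl_iff_disjoint_right.2 hi.2)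
  obtain ⟨D₁, ⟨hD₁D, hD₁gate⟩, hD₁, hD₁A⟩ :=
    mem_closure_iff_nhds.1 (mem_avoidingCore_iff.1 hD A hA) _ hnhds
  obtain ⟨D₂, hD₂, hD₂A, hD₂Y⟩ := hj A hA
  have hpt : ∀ i, i < j → i ∉ s → ∃ y ∈ gate net r i, y ∉ A ∧ ∃ x ∈ (D : Set E), dist y x < η := by
    intro i hij his
    simp only [s, Finset.mem_filter, Finset.mem_range, hij, true_and, not_disjoint_iff] at his
    obtain ⟨x, hxD, hx⟩ := his
    obtain ⟨z, hzx, hz⟩ := mem_closure_iff.1 hx _ Metric.isOpen_ball (Metric.mem_ball_self hη)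
    obtain ⟨y, ⟨hy₁, hy₂⟩, hyA⟩ := (hA.dense_compl h.meagre).inter_open_nonempty
      (gate net r i ∩ Metric.ball x η) ((hopen i).inter Metric.isOpen_ball) ⟨z, hz, hzx⟩
    exact ⟨y, hy₁, hyA, x, hxD, hy₂⟩
  have : Nonempty E := ⟨hD₁.1.some⟩
  choose! y hygate hyA hyD using hpt
  let t : Finset ℕ := {i ∈ Finset.range j | i ∉ s}
  have ht : ∀ i, i ∈ t ↔ i < j ∧ i ∉ s := fun i => by simp [t]
  let Q : Compacts E := ⟨y '' (t : Set ℕ), (t.finite_toSet.image y).isCompact⟩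
  -- `D₁` obeys the demands in `s`, `D₂` obeys the `j`-th one, and `Q` meets the remaining earlier
  -- gates. All three miss the `j`-th net and lie near `D`.
  let D₃ : Compacts E := D₁ ⊔ D₂ ⊔ Q
  have hD₁₃ : (D₁ : Set E) ⊆ D₃ := fun x hx => .inl (.inl hx)
  have hD₂₃ : (D₂ : Set E) ⊆ D₃ := fun x hx => .inl (.inr hx)
  have hD₃A : Disjoint (D₃ : Set E) A := by
    simp only [D₃, Compacts.coe_sup, disjoint_union_left]
    refine ⟨⟨hD₁A, hD₂A⟩, disjoint_left.2 ?_⟩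
    rintro _ ⟨i, hi, rfl⟩
    rw [Finset.mem_coe, ht] at hi
    exact hyA i hi.1 hi.2
  have hD₃N : D₃ ∈ 𝒩 j := by
    refine hηN _ (HausdorffClose.union_left (hD₁D.union_left fun x hx => ?_) ?_)
    · exact ⟨x, hYD (hD₂Y hx), by simpa⟩
    · rintro _ ⟨i, hi, rfl⟩
      rw [Finset.mem_coe, ht] at hi
      exact hyD i hi.1 hi.2
  have hD₃c : D₃ ∈ constrained T 𝒟 (insert j s) := by
    refine ⟨hD₁.1.mono (inter_subset_inter_left _ hD₁₃), fun i hi => ?_⟩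
    rcases Finset.mem_insert.1 hi with rfl | his
    · exact h.isUpwardClosed_constraint i D₂ hD₂ _ hD₂₃
    · refine h.isUpwardClosed_constraint i D₁ ((hD₁.2 i).resolve_left ?_) _ hD₁₃
      rw [not_nonempty_iff_eq_empty, ← disjoint_iff_inter_eq_empty,
        ← subset_compl_iff_disjoint_right]
      exact mem_iInter₂.1 hD₁gate i his
  have hwit : IsStageWitness I T 𝒟 net r j s D₃ :=
    ⟨hBcore _ hD₃c (hD₃A.mono_right subset_union_left), fun i hi his =>
      ⟨y i, .inr ⟨i, Finset.mem_coe.2 ((ht i).2 ⟨hi, his⟩), rfl⟩, hygate i hi his⟩⟩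
  -- The new witness may have a different index set and is tied to `D` only through `𝒩 j`.
  obtain ⟨s', D₄, hD₄N, hD₄, hD₄net⟩ :=
    h.adapted j ⟨s, D₃, hD₃N, hwit, hD₃A.mono_right subset_union_right⟩
  obtain ⟨D₅, hD₅, hD₅D₄⟩ := h.exists_mem_core_gated (j := j + 1) hD₄.mem
    (fun i hi his => hD₄.hits i (by
      rcases Nat.lt_succ_iff_lt_or_eq.1 hi with hi | rfl
      · exact hi
      · exact (his (Finset.mem_insert_self _ _)).elim) fun hi => his (Finset.mem_insert_of_mem hi))
    (h.pos (j + 1))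
  refine ⟨D₅, hD₅, ?_, disjoint_left.2 fun x hx hxg => ?_⟩
  · exact (hD₅D₄.trans (hN _ hD₄N)).mono (by linarith)
  -- The factor `3`: `D₅` is within `2 * r (j + 1)` of `D₄`, and the gate has radius `r (j + 1)`.
  -- The strict inequality `hxz` leaves slack for passing to the closure of the gate.
  · obtain ⟨z, hz, hxz⟩ := hD₅D₄.1 x hx
    obtain ⟨w, hw, hxw⟩ : ∃ w ∈ gate net r j, dist x w < r (j + 1) + r (j + 1) - dist x z := by
      exact Metric.mem_closure_iff.1 hxg _ (by linarith)
    obtain ⟨a, ha, hwa⟩ := Metric.mem_thickening_iff.1 hw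
    refine disjoint_left.1 hD₄net hz (Metric.mem_thickening_iff.2 ⟨a, ha, ?_⟩)
    have h₁ := dist_triangle z x a
    have h₂ := dist_triangle x w a
    rw [dist_comm z x] at h₁
    linarith

end IsGateSystem

/-! ### Meagerness of hit sets and the fusion criterion. -/

section Fusion

variable {E : Type*} [TopologicalSpace E]

theorem exists_nat_basis (X : Type*) [TopologicalSpace X] [SecondCountableTopology X] :
    ∃ B : ℕ → Set X, (∀ n, IsOpen (B n)) ∧
      ∀ x, ∀ O : Set X, IsOpen O → x ∈ O → ∃ n, x ∈ B n ∧ B n ⊆ O := by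
  obtain ⟨B, hB⟩ := ((countable_countableBasis X).insert ∅).exists_eq_range (insert_nonempty _ _)
  refine ⟨B, fun n => ?_, fun x O hO hx => ?_⟩
  · rcases hB.symm ▸ mem_range_self n with h | h
    · rw [h]
      exact isOpen_empty
    · exact isOpen_of_mem_countableBasis h
  · obtain ⟨N, hN, hxN, hNO⟩ := (isBasis_countableBasis X).exists_subset_of_mem_open hx hO
    obtain ⟨n, rfl⟩ : N ∈ range B := hB ▸ mem_insert_of_mem _ hN
    exact ⟨n, hxN, hNO⟩

theorem isMeagerIn_hitSet_of_subset_closure [T2Space E] {𝓕 : Set (Compacts E)} {K : Compacts E}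
    (h : 𝓕 ⊆ closure {D ∈ 𝓕 | Disjoint (D : Set E) K}) : IsMeagerIn (hitSet (K : Set E)) 𝓕 := by
  refine IsNowhereDense.isMeagre ?_
  have hclosed : IsClosed ((↑) ⁻¹' hitSet (K : Set E) : Set 𝓕) :=
    (Compacts.isClosed_inter_nonempty_of_isClosed K.isCompact.isClosed).preimage
      continuous_subtype_val
  rw [hclosed.isNowhereDense_iff, eq_empty_iff_forall_notMem]
  intro D hD
  rw [mem_interior] at hD
  obtain ⟨_, hsub, ⟨O, hO, rfl⟩, hDO⟩ := hD
  obtain ⟨D', hD'O, hD', hdisj⟩ := mem_closure_iff.1 (h D.2) O hO hDO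
  exact not_disjoint_iff_nonempty_inter.2 (@hsub ⟨D', hD'⟩ hD'O) hdisj

theorem IsMeagerIn.mono {X : Type*} [TopologicalSpace X] {𝒜 ℬ 𝓕 : Set X} (h : IsMeagerIn ℬ 𝓕)
    (hsub : 𝒜 ⊆ ℬ) : IsMeagerIn 𝒜 𝓕 :=
  IsMeagre.mono (preimage_mono hsub) h

theorem hitSet_mono {A B : Set E} (h : A ⊆ B) : hitSet A ⊆ hitSet B :=
  fun _ hD => hD.mono (inter_subset_inter_right _ h)

theorem isMeagerIn_hitSet_of_isCountablyCovered {I 𝓕 : Set (Compacts E)}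
    (h : ∀ K ∈ I, IsMeagerIn (hitSet (K : Set E)) 𝓕) {G : Set E} (hG : IsCountablyCovered I G) :
    IsMeagerIn (hitSet G) 𝓕 := by
  obtain ⟨K, hK, hGK⟩ := hG
  refine (isMeagre_iUnion fun n => h (K n) (hK n)).mono ?_
  rintro D ⟨x, hxD, hxG⟩
  obtain ⟨n, hn⟩ := mem_iUnion.1 (hGK hxG)
  exact mem_iUnion.2 ⟨n, x, hxD, hn⟩

/-- A `G_δ` set that is not covered by countably many members of `I` contains a nonempty `G_δ` set
none of whose nonempty relatively open subsets is. -/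
theorem IsCompactIdeal.exists_isGδ_locally_not_covered {E : Type*} [MetricSpace E]
    [SecondCountableTopology E] {I : Set (Compacts E)}
    (hI : IsCompactIdeal I) {G : Set E} (hG : IsGδ G) (hcov : ¬ IsCountablyCovered I G) :
    ∃ G' ⊆ G, IsGδ G' ∧ G'.Nonempty ∧
      ∀ O, IsOpen O → (G' ∩ O).Nonempty → ¬ IsCountablyCovered I (G' ∩ O) := by
  obtain ⟨V, hVo, hV⟩ := exists_nat_basis E
  -- Removing the basic open sets with small trace removes only a small part of `G`, so no small
  -- relatively open part can remain.
  let s : Set ℕ := {m | IsCountablyCovered I (G ∩ V m)}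
  have hs : IsCountablyCovered I (⋃ m ∈ s, G ∩ V m) :=
    hI.isCountablyCovered_biUnion s.to_countable fun m hm => hm
  have hsplit : ∀ O, G ∩ O ⊆ ((G \ ⋃ m ∈ s, V m) ∩ O) ∪ ⋃ m ∈ s, G ∩ V m := by
    rintro O x ⟨hxG, hxO⟩
    by_cases hx : x ∈ ⋃ m ∈ s, V m
    · obtain ⟨m, hm, hxm⟩ := mem_iUnion₂.1 hx
      exact .inr (mem_iUnion₂.2 ⟨m, hm, hxG, hxm⟩)
    · exact .inl ⟨⟨hxG, hx⟩, hxO⟩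
  refine ⟨G \ ⋃ m ∈ s, V m, sdiff_subset, ?_, ?_, ?_⟩
  · exact hG.inter (isOpen_biUnion fun m _ => hVo m).isClosed_compl.isGδ
  · by_contra hempty
    rw [not_nonempty_iff_eq_empty] at hempty
    refine hcov (hs.mono ?_)
    simpa [hempty] using hsplit univ
  · rintro O hO ⟨x, ⟨hxG, hx⟩, hxO⟩ hGO
    obtain ⟨m, hxm, hmO⟩ := hV x O hO hxO
    refine hx (mem_iUnion₂.2 ⟨m, ?_, hxm⟩)
    exact (hI.isCountablyCovered_union hGO hs).mono
      ((inter_subset_inter_right _ hmO).trans (hsplit O))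

/-- A fusion criterion for the family of compact sets intersecting a `G_δ` set to be nonmeager. -/
theorem not_isMeagerIn_of_fusion [CompactSpace E] [T2Space E] {𝓕 : Set (Compacts E)}
    (h𝓕 : IsClosed 𝓕) {P : ℕ → Set E} (good : Set (Compacts E) → Set E → Prop)
    (hne : ∀ N V, good N V → (N ∩ 𝓕).Nonempty)
    (hhit : ∀ N V, good N V → ∀ D ∈ N ∩ 𝓕, ((D : Set E) ∩ closure V).Nonempty)
    (start : ∃ N V, good N V)
    (step : ∀ N V, good N V → ∀ W : Set (Compacts E), IsOpen W → 𝓕 ⊆ closure (W ∩ 𝓕) →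
      ∀ k, ∃ N' V', good N' V' ∧ closure N' ⊆ N ∩ W ∧ closure V' ⊆ V ∩ P k) :
    ¬ IsMeagerIn (hitSet (⋂ k, P k)) 𝓕 := by
  intro hmeager
  have : CompactSpace 𝓕 := isCompact_iff_compactSpace.1 h𝓕.isCompact
  obtain ⟨t, ht, htG, htd⟩ := mem_residual.1 hmeager
  obtain ⟨U, hU, rfl⟩ := isGδ_iff_eq_iInter_nat.1 htG
  choose W hW hWU using fun k => isOpen_induced_iff.1 (hU k)
  have hWd : ∀ k, 𝓕 ⊆ closure (W k ∩ 𝓕) := by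
    intro k D hD
    have hd : Dense (U k) := htd.mono (iInter_subset _ _)
    rw [mem_closure_iff]
    intro O hO hDO
    obtain ⟨D', hD'O, hD'⟩ := hd.inter_open_nonempty _ (hO.preimage continuous_subtype_val)
      ⟨⟨D, hD⟩, hDO⟩
    rw [← hWU] at hD'
    exact ⟨D', hD'O, hD', D'.2⟩
  obtain ⟨N₀, V₀, h₀⟩ := start
  choose! N' V' hgood hN' hV' using step
  let p : ℕ → Set (Compacts E) × Set E :=
    fun k => Nat.rec (N₀, V₀) (fun k q => (N' q.1 q.2 (W k) k, V' q.1 q.2 (W k) k)) k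
  have hp : ∀ k, good (p k).1 (p k).2 := by
    intro k
    induction k with
    | zero => exact h₀
    | succ k ih => exact hgood _ _ ih (W k) (hW k) (hWd k) k
  have hpN : ∀ k, closure (p (k + 1)).1 ⊆ (p k).1 ∩ W k :=
    fun k => hN' _ _ (hp k) (W k) (hW k) (hWd k) k
  have hpV : ∀ k, closure (p (k + 1)).2 ⊆ (p k).2 ∩ P k :=
    fun k => hV' _ _ (hp k) (W k) (hW k) (hWd k) k
  obtain ⟨D, hD⟩ := IsCompact.nonempty_iInter_of_sequence_nonempty_isCompact_isClosed
    (fun k => closure (p k).1 ∩ 𝓕)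
    (fun k => inter_subset_inter_left _
      ((hpN k).trans (inter_subset_left.trans subset_closure)))
    (fun k => (hne _ _ (hp k)).mono (inter_subset_inter_left _ subset_closure))
    (isClosed_closure.inter h𝓕).isCompact (fun k => isClosed_closure.inter h𝓕)
  rw [mem_iInter] at hD
  have hD𝓕 : D ∈ 𝓕 := (hD 0).2
  obtain ⟨x, hx⟩ := IsCompact.nonempty_iInter_of_sequence_nonempty_isCompact_isClosed
    (fun k => (D : Set E) ∩ closure (p k).2)
    (fun k => inter_subset_inter_right _
      ((hpV k).trans (inter_subset_left.trans subset_closure)))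
    (fun k => hhit _ _ (hp k) D ⟨(hpN k (hD (k + 1)).1).1, hD𝓕⟩)
    (D.isCompact.inter_right isClosed_closure)
    (fun k => D.isCompact.isClosed.inter isClosed_closure)
  rw [mem_iInter] at hx
  refine ht (a := ⟨D, hD𝓕⟩) (mem_iInter.2 fun k => ?_)
    ⟨x, (hx 0).1, mem_iInter.2 fun k => (hpV k (hx (k + 1)).2).2⟩
  rw [← hWU]
  exact (hpN k (hD (k + 1)).1).2

end Fusion

/-! ### The representation when the point closure is not small. -/

section Representation

variable {E : Type*} [MetricSpace E] [CompactSpace E] {I : Set (Compacts E)}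

/-- The closure of the set of points `x` with `{x} ∈ I`. -/
def pointClosure (I : Set (Compacts E)) : Set E :=
  closure {x | {x} ∈ I}

theorem exists_finite_net (hI : IsCompactIdeal I) {ε : ℝ} (hε : 0 < ε) :
    ∃ s : Set E, IsCompact s ∧ IsCountablyCovered I s ∧
      ∀ x ∈ pointClosure I, ∃ a ∈ s, dist x a < ε := by
  obtain ⟨t, htI, ht, hcov⟩ := Metric.finite_approx_of_totallyBounded
    (isCompact_univ.totallyBounded.subset (subset_univ {x : E | ({x} : Compacts E) ∈ I}))
    (ε / 2) (half_pos hε)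
  refine ⟨t, ht.isCompact, ?_, fun x hx => ?_⟩
  · have := hI.isCountablyCovered_biUnion ht.countable (A := fun x => {x}) fun x hx => by
      have hxI : ({x} : Compacts E) ∈ I := htI hx
      exact Compacts.coe_singleton x ▸ IsCountablyCovered.of_mem hxI
    simpa using this
  · obtain ⟨y, hy, hxy⟩ := Metric.mem_closure_iff.1 hx (ε / 2) (half_pos hε)
    obtain ⟨a, ha, hya⟩ := mem_iUnion₂.1 (hcov hy)
    refine ⟨a, ha, (dist_triangle x y a).trans_lt ?_⟩
    rw [Metric.mem_ball] at hya
    linarith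

theorem exists_upwardClosed_representation_of_pointClosure_notMem (hI : IsCompactIdeal I)
    (hGδ : IsGδ I) (hstar : HasPropertyStar I) (hmeagre : ∀ K ∈ I, IsMeagre (K : Set E))
    (hT : ¬ IsCountablyCovered I (pointClosure I)) :
    ∃ 𝓕 : Set (Compacts E), IsCompact 𝓕 ∧ IsUpwardClosed 𝓕 ∧
      ∀ G : Set E, IsGδ G → (IsCountablyCovered I G ↔ IsMeagerIn (hitSet G) 𝓕) := by
  obtain ⟨C, hC, hCI⟩ := hI.isSigmaAvoidable_compl hstar hGδ
  obtain ⟨V, hVo, hV⟩ := exists_nat_basis E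
  obtain ⟨B, hBo, hB⟩ := exists_nat_basis (Compacts E)
  choose! net hnetc hnetcov hnetd using fun ε => exists_finite_net hI (ε := ε)
  let 𝒟' : ℕ → ℕ → Set (Compacts E) := fun n m =>
    transversals {M ∈ C n | (M : Set E) ⊆ closure (V m)}
  have h𝒟' : ∀ n m A, IsCountablyCovered I A →
      ∃ D ∈ 𝒟' n m, Disjoint (D : Set E) A ∧ (D : Set E) ⊆ closure (V m) := by
    intro n m A hA
    obtain ⟨D, hD, hDA⟩ := hC n A hA
    refine ⟨⟨D ∩ closure (V m), D.isCompact.inter_right isClosed_closure⟩, ?_,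
      hDA.mono_left inter_subset_left, inter_subset_right⟩
    rintro M ⟨hMC, hMV⟩
    obtain ⟨x, hxD, hxM⟩ := hD M hMC
    exact ⟨x, ⟨hxD, hMV hxM⟩, hxM⟩
  let 𝒟 : ℕ → Set (Compacts E) := fun j => 𝒟' j.unpair.1.unpair.1 j.unpair.1.unpair.2
  let 𝒩 : ℕ → Set (Compacts E) := fun j => B j.unpair.2.unpair.1
  -- The extra coordinate `k` makes each triple recur at arbitrarily late stages, where the radii
  -- are as small as needed.
  have hidx : ∀ n m l k, ∃ j ≥ k, 𝒟 j = 𝒟' n m ∧ 𝒩 j = B l := fun n m l k =>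
    ⟨Nat.pair (Nat.pair n m) (Nat.pair l k),
      (Nat.right_le_pair l k).trans (Nat.right_le_pair _ _), by simp [𝒟], by simp [𝒩]⟩
  obtain ⟨r, hr0, hr1, hr2⟩ := exists_adapted_radii I (pointClosure I) 𝒟 𝒩 hnetc
  have h𝒟up : ∀ j, IsUpwardClosed (𝒟 j) := fun j D hD D' hDD' M hM =>
    (hD M hM).mono (inter_subset_inter_left _ hDD')
  have hsys : IsGateSystem I (pointClosure I) 𝒟 𝒩 net r :=
    { ideal := hI
      meagre := hmeagre
      exists_notMem := fun A hA => by
        by_contra! hcon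
        exact hT (hA.mono hcon)
      isClosed_constraint := fun j => isClosed_transversals _
      isUpwardClosed_constraint := h𝒟up
      net_covered := hnetcov
      net_dense := hnetd
      pos := hr0
      halve := hr1
      adapted := hr2 }
  let 𝓕 := avoidingCore I (gated (pointClosure I) 𝒟 net r)
  have hgated : IsClosed (gated (pointClosure I) 𝒟 net r) :=
    isClosed_gated isClosed_closure hsys.isClosed_constraint
  have h𝓕c : IsClosed 𝓕 := isClosed_avoidingCore
  have h𝓕up : IsUpwardClosed 𝓕 := (isUpwardClosed_gated h𝒟up).avoidingCore hmeagre
  refine ⟨𝓕, h𝓕c.isCompact, h𝓕up, fun G hG => ⟨?_, fun hmeager => ?_⟩⟩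
  · exact isMeagerIn_hitSet_of_isCountablyCovered fun K hK =>
      isMeagerIn_hitSet_of_subset_closure (avoidingCore_subset_closure hI (.of_mem hK))
  by_contra hcov
  obtain ⟨G', hG'G, hG', hG'ne, hloc⟩ := hI.exists_isGδ_locally_not_covered hG hcov
  replace hmeager := hmeager.mono (hitSet_mono hG'G)
  obtain ⟨P, hP, rfl⟩ := isGδ_iff_eq_iInter_nat.1 hG'
  clear hG' hG'G hcov hG
  set G' := ⋂ k, P k with hG'
  let good : Set (Compacts E) → Set E → Prop := fun N U => IsOpen N ∧ (N ∩ 𝓕).Nonempty ∧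
    IsOpen U ∧ ∀ D ∈ N ∩ 𝓕, ((D : Set E) ∩ closure (G' ∩ U)).Nonempty
  -- Near a member containing the closure of `V m` there is an open family all of whose members in
  -- `𝓕` meet the closure of `G' ∩ V m`: that closure is not in `I`, so it lies in some `C n`, and
  -- missing the right gate enforces the demand.
  have key : ∀ D ∈ 𝓕, ∀ O, IsOpen O → D ∈ O → ∀ m, closure (V m) ⊆ D → (G' ∩ V m).Nonempty →
      ∃ N, good N (V m) ∧ closure N ⊆ O := by
    intro D hD O hO hDO m hmD hne
    obtain ⟨n, hn⟩ : ∃ n, (⟨closure (G' ∩ V m), isClosed_closure.isCompact⟩ : Compacts E) ∈ C n := by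
      rw [← mem_iUnion, ← hCI]
      exact fun hmem => hloc _ (hVo m) hne ((IsCountablyCovered.of_mem hmem).mono subset_closure)
    obtain ⟨N₁, hN₁, hN₁c, hN₁O⟩ := exists_mem_nhds_isClosed_subset (hO.mem_nhds hDO)
    have hN₀ : D ∈ interior N₁ := mem_interior_iff_mem_nhds.2 hN₁
    obtain ⟨δ, hδ, hδN⟩ := exists_hausdorffClose_of_mem_nhds (isOpen_interior.mem_nhds hN₀)
    obtain ⟨l, hDl, hl⟩ := hB D _ isOpen_interior
      (mem_interior_iff_mem_nhds.2 (hausdorffClose_mem_nhds D (half_pos hδ)))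
    obtain ⟨k, hk⟩ := (hsys.tendsto.eventually_lt_const (show 0 < δ / 4 by positivity)).exists
    obtain ⟨j, hjk, hj𝒟, hj𝒩⟩ := hidx n m l k
    have hrj : r (j + 1) < δ / 4 := (hsys.antitone (by omega : k ≤ j + 1)).trans_lt hk
    obtain ⟨D', hD'𝓕, hD'D, hD'g⟩ := hsys.exists_mem_core_gated_disjoint hD hmD (j := j)
      (by rw [hj𝒟]; exact h𝒟' n m) (by rw [hj𝒩]; exact hBo l) (by rwa [hj𝒩]) (δ := δ / 2)
      (by rw [hj𝒩]; exact fun D' hD' => (interior_subset (hl hD') :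
        D' ∈ {D' : Compacts E | HausdorffClose (δ / 2) (D' : Set E) D}))
    have hD'N : D' ∈ interior N₁ := hδN _ (hD'D.mono (by linarith))
    refine ⟨interior N₁ ∩ {D | (D : Set E) ⊆ (closure (gate net r j))ᶜ}, ⟨?_, ?_, hVo m, ?_⟩, ?_⟩
    · exact isOpen_interior.inter (Compacts.isOpen_subsets_of_isOpen isClosed_closure.isOpen_compl)
    · exact ⟨D', ⟨hD'N, subset_compl_iff_disjoint_right.2 hD'g⟩, hD'𝓕⟩
    · rintro D₁ ⟨⟨-, hD₁g⟩, hD₁⟩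
      have hD₁j := ((avoidingCore_subset hI hgated hD₁).2 j).resolve_left (by
        rw [not_nonempty_iff_eq_empty, ← disjoint_iff_inter_eq_empty,
          ← subset_compl_iff_disjoint_right]
        exact hD₁g)
      rw [hj𝒟] at hD₁j
      exact hD₁j _ ⟨hn, closure_mono inter_subset_right⟩
    · exact (closure_mono (inter_subset_left.trans interior_subset)).trans
        (hN₁c.closure_eq.subset.trans hN₁O)
  refine not_isMeagerIn_of_fusion h𝓕c good (fun N U h => h.2.1)
    (fun N U h D hD => (h.2.2.2 D hD).mono
      (inter_subset_inter_right _ (closure_mono inter_subset_right))) ?_ ?_ hmeager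
  · obtain ⟨D, hD⟩ := hsys.core_gated_nonempty
    obtain ⟨x, hx⟩ := hG'ne
    obtain ⟨m, hxm, -⟩ := hV x univ isOpen_univ (mem_univ x)
    obtain ⟨N, hN, -⟩ := key ⊤ (h𝓕up D hD ⊤ (by simp)) univ isOpen_univ (mem_univ _) m
      (by simp) ⟨x, hx, hxm⟩
    exact ⟨N, _, hN⟩
  · rintro N U ⟨hNo, ⟨D₀, hD₀N, hD₀⟩, hUo, hU⟩ W hW hWd k
    obtain ⟨D, hDN, hDW, hD⟩ := mem_closure_iff.1 (hWd hD₀) N hNo hD₀N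
    obtain ⟨x, hxD, hx⟩ := hU D ⟨hDN, hD⟩
    have hcont : Continuous fun a : E => D ⊔ ({a} : Compacts E) :=
      continuous_const.sup Compacts.continuous_singleton
    have hDx : D ⊔ {x} = D := sup_eq_left.2 (by
      intro y hy
      rw [Compacts.mem_singleton] at hy
      exact hy ▸ hxD)
    -- The point `x` is only in the closure of `G' ∩ U`; it is traded for a nearby `a` in the set
    -- itself, which upward closure allows adding to `D`.
    obtain ⟨a, haNW, haG, haU⟩ := mem_closure_iff.1 hx _ ((hNo.inter hW).preimage hcont)
      (by simpa only [mem_preimage, hDx] using ⟨hDN, hDW⟩)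
    obtain ⟨δ, hδ, hδN⟩ := exists_hausdorffClose_of_mem_nhds ((hNo.inter hW).mem_nhds haNW)
    have hO : U ∩ P k ∩ Metric.ball a δ ∈ nhds a :=
      ((hUo.inter (hP k)).inter Metric.isOpen_ball).mem_nhds
        ⟨⟨haU, mem_iInter.1 haG k⟩, Metric.mem_ball_self hδ⟩
    obtain ⟨Z, hZ, hZc, hZO⟩ := exists_mem_nhds_isClosed_subset hO
    obtain ⟨m, ham, hmZ⟩ := hV a _ isOpen_interior (mem_interior_iff_mem_nhds.2 hZ)
    have hmZ' : closure (V m) ⊆ U ∩ P k ∩ Metric.ball a δ :=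
      (closure_minimal (hmZ.trans interior_subset) hZc).trans hZO
    let Y : Compacts E := ⟨closure (V m), isClosed_closure.isCompact⟩
    obtain ⟨N', hN', hN'N⟩ := key (D ⊔ {a} ⊔ Y)
      (h𝓕up D hD _ (fun y hy => .inl (.inl hy))) _ (hNo.inter hW)
      (hδN _ ((HausdorffClose.refl hδ _).union_left fun y hy =>
        ⟨a, .inr rfl, (hmZ' hy).2⟩)) m (fun y hy => .inr hy) ⟨a, haG, ham⟩
    exact ⟨N', V m, hN', hN'N, fun y hy => (hmZ' hy).1⟩

end Representation

/-! ### Cells off a closed set, and the case of a small point closure. -/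

section Cells

variable {E : Type*} [MetricSpace E] [CompactSpace E]

/-- The complement of a closed set `T` contains a family of disjoint nonempty open sets with dense
union that is locally finite away from `T` and whose members are small near `T`. -/
theorem exists_locallyFinite_cells.{v} {E : Type v} [MetricSpace E] [CompactSpace E] {T : Set E}
    (hT : IsClosed T) :
    ∃ (ι : Type v) (u : ι → Set E), (∀ a, IsOpen (u a)) ∧ (∀ a, (u a).Nonempty) ∧
      (Pairwise fun a b => Disjoint (u a) (u b)) ∧
      (∀ x ∉ T, ∃ O ∈ nhds x, {a | (u a ∩ O).Nonempty}.Finite) ∧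
      Tᶜ ⊆ closure (⋃ a, u a) ∧
      ∀ a, ∃ c ρ, u a ⊆ Metric.closedBall c ρ ∧ ∀ y ∈ T, 2 * ρ < dist c y := by
  let X := ↥(Tᶜ)
  have : LocallyCompactSpace X := hT.isOpen_compl.locallyCompactSpace
  have hbasis : ∀ x : X, (nhds x).HasBasis
      (fun ρ : ℝ => 0 < ρ ∧ ∀ y ∈ T, 2 * ρ < dist (x : E) y) (Metric.ball x) := by
    intro x
    refine Metric.nhds_basis_ball.restrict fun ρ hρ => ?_
    obtain ⟨R, hR, hRT⟩ := Metric.isOpen_iff.1 hT.isOpen_compl x x.2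
    refine ⟨min ρ (R / 3), lt_min hρ (by positivity), fun y hy => ?_,
      Metric.ball_subset_ball (min_le_left _ _)⟩
    have hy' : R ≤ dist (x : E) y := by
      by_contra! hlt
      exact hRT (by rwa [Metric.mem_ball, dist_comm]) hy
    linarith [min_le_right ρ (R / 3)]
  obtain ⟨α, c, ρ, hρ, hcov, hlf⟩ :=
    refinement_of_locallyCompact_sigmaCompact_of_nhds_basis hbasis
  let O : α → Set X := fun a => Metric.ball (c a) (ρ a)
  have hOo : ∀ a, IsOpen (O a) := fun a => Metric.isOpen_ball
  -- Disjointness comes from removing the closures of all earlier balls in a well-order. Local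
  -- finiteness keeps the cells open, and the least ball meeting a given open set gives density.
  let u : α → Set X := fun a => O a \ ⋃ b : {b // WellOrderingRel b a}, closure (O b)
  have huo : ∀ a, IsOpen (u a) := fun a => (hOo a).sdiff
    ((hlf.closure.comp_injective Subtype.val_injective).isClosed_iUnion fun _ => isClosed_closure)
  have hdisj : ∀ a b, WellOrderingRel b a → Disjoint (u a) (u b) := fun a b hba =>
    disjoint_left.2 fun x hxa hxb => hxa.2 (mem_iUnion.2 ⟨⟨b, hba⟩, subset_closure hxb.1⟩)
  have hval : Topology.IsOpenEmbedding ((↑) : X → E) := hT.isOpen_compl.isOpenEmbedding_subtypeVal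
  refine ⟨{a // (u a).Nonempty}, fun a => (↑) '' u a, fun a => hval.isOpenMap _ (huo a),
    fun a => a.2.image _, ?_, ?_, ?_, ?_⟩
  · intro a b hab
    refine (disjoint_image_iff Subtype.val_injective).2 ?_
    rcases trichotomous_of WellOrderingRel (a : α) b with h | h | h
    · exact (hdisj _ _ h).symm
    · exact (hab (Subtype.ext h)).elim
    · exact hdisj _ _ h
  · intro x hx
    obtain ⟨Q, hQ, hfin⟩ := hlf ⟨x, hx⟩
    refine ⟨(↑) '' Q, hval.isOpenMap.image_mem_nhds hQ, ?_⟩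
    refine (hfin.preimage Subtype.val_injective.injOn).subset ?_
    rintro a ⟨_, ⟨y, hy, rfl⟩, z, hz, hzy⟩
    exact ⟨y, hy.1, Subtype.val_injective hzy ▸ hz⟩
  · intro x hx
    rw [mem_closure_iff]
    intro Q hQ hxQ
    let Q' : Set X := (↑) ⁻¹' Q
    have hQ' : IsOpen Q' := hQ.preimage continuous_subtype_val
    let S : Set α := {a | (Q' ∩ O a).Nonempty}
    have hS : S.Nonempty := by
      obtain ⟨a, ha⟩ := mem_iUnion.1 (hcov.symm ▸ mem_univ (⟨x, hx⟩ : X))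
      exact ⟨a, ⟨x, hx⟩, hxQ, ha⟩
    have hwf : WellFounded (WellOrderingRel (α := α)) := IsWellFounded.wf
    obtain ⟨y, hyQ, hy⟩ := hwf.min_mem S hS
    have hyu : y ∈ u (hwf.min S hS) := by
      refine ⟨hy, fun hmem => ?_⟩
      obtain ⟨b, hb⟩ := mem_iUnion.1 hmem
      exact hwf.not_lt_min S (mem_closure_iff.1 hb Q' hQ' hyQ) b.2
    exact ⟨y, hyQ, mem_iUnion.2 ⟨⟨_, y, hyu⟩, y, hyu, rfl⟩⟩
  · rintro ⟨a, ha⟩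
    refine ⟨c a, ρ a, ?_, (hρ a).2⟩
    rintro _ ⟨x, hx, rfl⟩
    exact Metric.ball_subset_closedBall hx.1

/-- A closed nowhere dense set `T` determines an upward closed compact family in which the family
of compact sets intersecting `G` is meager only if `G ⊆ T`. -/
theorem exists_upwardClosed_representation_of_subset {T : Set E} (hT : IsClosed T)
    (hd : Dense Tᶜ) :
    ∃ 𝓕 : Set (Compacts E), IsCompact 𝓕 ∧ IsUpwardClosed 𝓕 ∧
      ∀ G : Set E, G ⊆ T ↔ IsMeagerIn (hitSet G) 𝓕 := by
  obtain ⟨ι, u, huo, hune, hdisj, hlf, hucov, husmall⟩ := exists_locallyFinite_cells hT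
  let 𝓕 : Set (Compacts E) := {D | ((D : Set E) ∩ T).Nonempty ∨ ∃ a, u a ⊆ D}
  have hsup : ∀ a, IsClosed {D : Compacts E | u a ⊆ D} := by
    intro a
    have : {D : Compacts E | u a ⊆ D} =
        ⋂ x ∈ u a, {D : Compacts E | ((D : Set E) ∩ {x}).Nonempty} := by
      ext D
      simp [subset_def]
    rw [this]
    exact isClosed_biInter fun x _ =>
      Compacts.isClosed_inter_nonempty_of_isClosed isClosed_singleton
  have hTo : IsOpen {D : Compacts E | (D : Set E) ⊆ Tᶜ} :=
    Compacts.isOpen_subsets_of_isOpen hT.isOpen_compl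
  have h𝓕c : IsClosed 𝓕 := by
    rw [← isOpen_compl_iff, isOpen_iff_mem_nhds]
    intro D hD
    simp only [𝓕, mem_compl_iff, mem_ofPred_eq, not_or, not_exists] at hD
    have hDT : (D : Set E) ⊆ Tᶜ := fun x hx hxT => hD.1 ⟨x, hx, hxT⟩
    -- Only finitely many cells meet a neighbourhood of `D`, so containing one of them is a closed
    -- condition there.
    have hfin : ∃ O, IsOpen O ∧ (D : Set E) ⊆ O ∧ {a | (u a ∩ O).Nonempty}.Finite := by
      refine D.isCompact.induction_on (p := fun s => ∃ O, IsOpen O ∧ s ⊆ O ∧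
        {a | (u a ∩ O).Nonempty}.Finite) ⟨∅, isOpen_empty, subset_rfl, by simp⟩ ?_ ?_ ?_
      · rintro s t hst ⟨O, hO, htO, hfin⟩
        exact ⟨O, hO, hst.trans htO, hfin⟩
      · rintro s t ⟨O, hO, hsO, hfin⟩ ⟨O', hO', htO', hfin'⟩
        refine ⟨O ∪ O', hO.union hO', union_subset_union hsO htO', (hfin.union hfin').subset ?_⟩
        rintro a ⟨x, hxu, hx | hx⟩
        exacts [.inl ⟨x, hxu, hx⟩, .inr ⟨x, hxu, hx⟩]
      · intro x hx
        obtain ⟨O, hO, hfin⟩ := hlf x (hDT hx)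
        refine ⟨interior O, mem_nhdsWithin_of_mem_nhds (interior_mem_nhds.2 hO), interior O,
          isOpen_interior, subset_rfl, hfin.subset ?_⟩
        rintro a ⟨y, hyu, hy⟩
        exact ⟨y, hyu, interior_subset hy⟩
    obtain ⟨O, hO, hDO, hfin⟩ := hfin
    have h₁ := hTo.mem_nhds hDT
    have h₂ := (Compacts.isOpen_subsets_of_isOpen hO).mem_nhds hDO
    have h₃ : (⋂ a ∈ {a | (u a ∩ O).Nonempty}, {D : Compacts E | u a ⊆ D}ᶜ) ∈ nhds D :=
      (Filter.biInter_mem hfin).2 fun a _ => (hsup a).isOpen_compl.mem_nhds (hD.2 a)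
    filter_upwards [h₁, h₂, h₃] with D' hD'₁ hD'₂ hD'₃
    rintro (⟨x, hxD, hxT⟩ | ⟨a, ha⟩)
    · exact hD'₁ hxD hxT
    · refine mem_iInter₂.1 hD'₃ a ?_ ha
      obtain ⟨x, hx⟩ := hune a
      exact ⟨x, hx, hD'₂ (ha hx)⟩
  have h𝓕up : IsUpwardClosed 𝓕 := fun D hD D' hDD' =>
    hD.imp (fun h => h.mono (inter_subset_inter_left _ hDD')) fun ⟨a, ha⟩ => ⟨a, ha.trans hDD'⟩
  let w : ι → Compacts E := fun a => ⟨closure (u a), isClosed_closure.isCompact⟩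
  have hwT : ∀ a, Disjoint (w a : Set E) T := by
    intro a
    obtain ⟨c, ρ, hc, hcT⟩ := husmall a
    refine disjoint_left.2 fun z hz hzT => ?_
    have hzc : z ∈ Metric.closedBall c ρ := closure_minimal hc Metric.isClosed_closedBall hz
    rw [Metric.mem_closedBall, dist_comm] at hzc
    linarith [hcT z hzT, dist_nonneg (x := c) (y := z)]
  refine ⟨𝓕, h𝓕c.isCompact, h𝓕up, fun G => ⟨fun hGT => ?_, fun hmeager x hxG => ?_⟩⟩
  · refine IsMeagerIn.mono (ℬ := hitSet T) ?_ (hitSet_mono hGT)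
    refine isMeagerIn_hitSet_of_subset_closure (K := ⟨T, hT.isCompact⟩) fun D hD => ?_
    by_cases hDT : Disjoint (D : Set E) T
    · exact subset_closure ⟨hD, hDT⟩
    obtain ⟨y, hyD, hyT⟩ := not_disjoint_iff.1 hDT
    rw [mem_closure_iff_nhds]
    intro N hN
    obtain ⟨δ, hδ, hδN⟩ := exists_hausdorffClose_of_mem_nhds hN
    have hDcl : D ∈ closure {K : Compacts E | (K : Set E).Finite ∧ (K : Set E) ⊆ Tᶜ} := by
      rw [Compacts.closure_finite_subsets, hd.closure_eq]
      exact subset_univ (D : Set E)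
    -- `D` is approximated by a finite set off `T` together with the closure of a small cell near
    -- `y`, which also misses `T` and secures membership in `𝓕`.
    obtain ⟨Q, hQD, -, hQT⟩ := mem_closure_iff_nhds.1 hDcl _ (hausdorffClose_mem_nhds D hδ)
    have hycl : y ∈ closure (⋃ a, u a) :=
      closure_minimal hucov isClosed_closure (hd y)
    obtain ⟨x, hx, hyx⟩ := Metric.mem_closure_iff.1 hycl (δ / 4) (by positivity)
    obtain ⟨a, hxa⟩ := mem_iUnion.1 hx
    obtain ⟨c, ρ, hc, hcT⟩ := husmall a
    have hxc := hc hxa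
    rw [Metric.mem_closedBall] at hxc
    have hρ : ρ < δ / 4 := by
      linarith [hcT y hyT, dist_triangle c x y, dist_comm x c, dist_comm x y]
    refine ⟨Q ⊔ w a, hδN _ (hQD.union_left fun z hz => ⟨y, hyD, ?_⟩),
      .inr ⟨a, fun z hz => .inr (subset_closure hz)⟩, ?_⟩
    · have hzc : z ∈ Metric.closedBall c ρ := closure_minimal hc Metric.isClosed_closedBall hz
      rw [Metric.mem_closedBall] at hzc
      linarith [dist_triangle z c y, dist_triangle c x y, dist_comm x c, dist_comm x y]
    · rw [Compacts.coe_sup, disjoint_union_left]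
      exact ⟨subset_compl_iff_disjoint_right.1 hQT, hwT a⟩
  · by_contra hxT
    obtain ⟨a, hxa⟩ : ∃ a, x ∈ closure (u a) := by
      by_contra! hcon
      obtain ⟨O, hO, hfin⟩ := hlf x hxT
      have hO' : O ∩ ⋂ a ∈ {a | (u a ∩ O).Nonempty}, (closure (u a))ᶜ ∈ nhds x :=
        Filter.inter_mem hO ((Filter.biInter_mem hfin).2 fun a _ =>
          isClosed_closure.isOpen_compl.mem_nhds (hcon a))
      obtain ⟨y, ⟨hyO, hy⟩, hyu⟩ := mem_closure_iff_nhds.1 (hucov hxT) _ hO'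
      obtain ⟨a, hya⟩ := mem_iUnion.1 hyu
      exact mem_iInter₂.1 hy a ⟨y, hya, hyO⟩ (subset_closure hya)
    choose p hp using hune
    -- A member of `𝓕` missing `S` meets neither `T` nor the chosen points of the other cells, so it
    -- contains `u a` and hence `x`. Such members form a nonempty open set in the Baire space `𝓕`.
    let S : Set E := T ∪ p '' {b | b ≠ a}
    have hS : IsClosed S := by
      rw [← isOpen_compl_iff, isOpen_iff_mem_nhds]
      intro z hz
      have hzT : z ∉ T := fun h => hz (.inl h)
      obtain ⟨O, hO, hfin⟩ := hlf z hzT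
      have hne : ∀ b ∈ {b | (u b ∩ O).Nonempty}, {y | b ≠ a → y ≠ p b} ∈ nhds z := by
        intro b _
        by_cases hb : b = a
        · simp [hb]
        · filter_upwards [isOpen_ne.mem_nhds (show z ≠ p b from fun h => hz (.inr ⟨b, hb, h.symm⟩))]
            with y hy _ using hy
      filter_upwards [hO, hT.isOpen_compl.mem_nhds hzT, (Filter.biInter_mem hfin).2 hne]
        with y hyO hyT hyb
      rintro (h | ⟨b, hb, rfl⟩)
      · exact hyT h
      · exact mem_iInter₂.1 hyb b ⟨_, hp b, hyO⟩ hb rfl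
    have : CompactSpace 𝓕 := isCompact_iff_compactSpace.1 h𝓕c.isCompact
    refine not_isMeagre_of_isOpen
      ((Compacts.isOpen_subsets_of_isOpen hS.isOpen_compl).preimage continuous_subtype_val)
      ⟨⟨w a, .inr ⟨a, subset_closure⟩⟩, ?_⟩ (IsMeagre.mono ?_ hmeager)
    · rintro z hz (h | ⟨b, hb, rfl⟩)
      · exact disjoint_left.1 (hwT a) hz h
      · obtain ⟨y, hyb, hya⟩ := mem_closure_iff.1 hz _ (huo b) (hp b)
        exact disjoint_left.1 (hdisj hb) hyb hya
    · rintro ⟨D, hD⟩ hDS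
      have hDS' : (D : Set E) ⊆ Sᶜ := hDS
      refine ⟨x, ?_, hxG⟩
      rcases hD with ⟨z, hzD, hzT⟩ | ⟨b, hb⟩
      · exact (hDS' hzD (.inl hzT)).elim
      · have hba : b = a := by
          by_contra hba
          exact hDS' (hb (hp b)) (.inr ⟨b, hba, rfl⟩)
        subst hba
        exact closure_minimal hb D.isCompact.isClosed hxa

end Cells

/-! ### The general case. -/

section Representation

variable {E : Type*} [TopologicalSpace E] [CompactSpace E] [PolishSpace E] {I : Set (Compacts E)}

/-- A `G_δ` ideal of meager compact sets with property `(*)` is represented by an upward closed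
compact family. -/
theorem exists_upwardClosed_representation (hI : IsCompactIdeal I)
    (hGδ : IsGδ I) (hstar : HasPropertyStar I) (hmeagre : ∀ K ∈ I, IsMeagre (K : Set E)) :
    ∃ 𝓕 : Set (Compacts E), IsCompact 𝓕 ∧ IsUpwardClosed 𝓕 ∧
      ∀ G : Set E, IsGδ G → (IsCountablyCovered I G ↔ IsMeagerIn (hitSet G) 𝓕) := by
  let _ := metrizableSpaceMetric E
  by_cases hT : IsCountablyCovered I (pointClosure I)
  · obtain ⟨𝓕, h𝓕c, h𝓕up, h𝓕⟩ := exists_upwardClosed_representation_of_subset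
      (T := pointClosure I) isClosed_closure (hT.dense_compl hmeagre)
    refine ⟨𝓕, h𝓕c, h𝓕up, fun G _ => ?_⟩
    rw [← h𝓕]
    refine ⟨?_, hT.mono⟩
    rintro ⟨K, hK, hGK⟩ x hx
    obtain ⟨n, hn⟩ := mem_iUnion.1 (hGK hx)
    refine subset_closure (hI.mem_of_subset (K n) (hK n) _ ?_)
    rw [Compacts.coe_singleton]
    exact singleton_subset_iff.2 hn
  · exact exists_upwardClosed_representation_of_pointClosure_notMem hI hGδ hstar hmeagre hT

/-- Outside the largest small open set `U` the traces of members of `I` are nowhere dense, since a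
relatively open small piece would enlarge `U`. Deleting `U` does not change which sets are small,
but the image of the family in `E` need not be upward closed. -/
theorem exists_representation (hI : IsCompactIdeal I) (hGδ : IsGδ I) (hstar : HasPropertyStar I) :
    ∃ 𝓕 : Set (Compacts E), IsCompact 𝓕 ∧
      ∀ G : Set E, IsGδ G → (IsCountablyCovered I G ↔ IsMeagerIn (hitSet G) 𝓕) := by
  obtain ⟨V, hVo, hV⟩ := exists_nat_basis E
  let s : Set ℕ := {m | IsCountablyCovered I (V m)}
  let U : Set E := ⋃ m ∈ s, V m
  have hUo : IsOpen U := isOpen_biUnion fun m _ => hVo m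
  have hU : IsCountablyCovered I U := hI.isCountablyCovered_biUnion s.to_countable fun m hm => hm
  have hVU : ∀ O, IsOpen O → IsCountablyCovered I O → O ⊆ U := by
    intro O hO hcov x hx
    obtain ⟨m, hxm, hmO⟩ := hV x O hO hx
    exact mem_biUnion (show m ∈ s from hcov.mono hmO) hxm
  let X := ↥(Uᶜ)
  have hemb : Topology.IsClosedEmbedding ((↑) : X → E) :=
    hUo.isClosed_compl.isClosedEmbedding_subtypeVal
  have : CompactSpace X := hemb.compactSpace
  have : PolishSpace X := hemb.polishSpace
  let f : Compacts X → Compacts E := Compacts.map (↑) hemb.continuous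
  have hf : Topology.IsEmbedding f := hemb.isEmbedding.compacts_map
  let I' : Set (Compacts X) := f ⁻¹' I
  have hI' : IsCompactIdeal I' :=
    { nonempty := ⟨⊥, hI.mem_of_subset ⊥ hI.bot_mem _ (by simp [f])⟩
      mem_of_subset := fun K hK L hLK => hI.mem_of_subset _ hK _ (image_mono hLK)
      sup_mem := fun K hK L hL => by
        refine hI.mem_of_subset _ (hI.sup_mem _ hK _ hL) _ ?_
        simp [f, image_union] }
  have hcov : ∀ G : Set E, IsCountablyCovered I G ↔ IsCountablyCovered I' ((↑) ⁻¹' G) := by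
    intro G
    constructor
    · rintro ⟨K, hK, hGK⟩
      refine ⟨fun n => ⟨(↑) ⁻¹' (K n : Set E), hemb.isCompact_preimage (K n).isCompact⟩,
        fun n => hI.mem_of_subset _ (hK n) _ (image_preimage_subset _ _), ?_⟩
      intro x hx
      obtain ⟨n, hn⟩ := mem_iUnion.1 (hGK hx)
      exact mem_iUnion.2 ⟨n, hn⟩
    · rintro ⟨K, hK, hGK⟩
      refine (hI.isCountablyCovered_union hU ⟨fun n => f (K n), hK, subset_rfl⟩).mono fun x hx => ?_
      by_cases hxU : x ∈ U
      · exact .inl hxU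
      · obtain ⟨n, hn⟩ := mem_iUnion.1 (hGK (show (⟨x, hxU⟩ : X) ∈ (↑) ⁻¹' G from hx))
        exact .inr (mem_iUnion.2 ⟨n, ⟨x, hxU⟩, hn, rfl⟩)
  have hstar' : HasPropertyStar I' := by
    intro K hK
    obtain ⟨G, hG, hKG, hGI⟩ := hstar (fun n => f (K n)) hK
    refine ⟨(↑) ⁻¹' G, hG.preimage hemb.continuous, ?_, fun L hL => hGI _ ?_⟩
    · exact iUnion_subset fun n x hx => hKG (mem_iUnion.2 ⟨n, x, hx, rfl⟩)
    · exact image_subset_iff.2 hL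
  have hmeagre : ∀ K ∈ I', IsMeagre (K : Set X) := by
    intro K hK
    refine IsNowhereDense.isMeagre ?_
    rw [K.isCompact.isClosed.isNowhereDense_iff, eq_empty_iff_forall_notMem]
    intro x hx
    rw [mem_interior] at hx
    obtain ⟨_, hsub, ⟨O, hO, rfl⟩, hxO⟩ := hx
    refine x.2 (hVU O hO ?_ hxO)
    rw [hcov]
    exact (IsCountablyCovered.of_mem hK).mono hsub
  obtain ⟨𝓕, h𝓕c, -, h𝓕⟩ := exists_upwardClosed_representation hI'
    (hGδ.preimage hf.continuous) hstar' hmeagre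
  refine ⟨f '' 𝓕, h𝓕c.image hf.continuous, fun G hG => ?_⟩
  rw [hcov, h𝓕 _ (hG.preimage hemb.continuous)]
  let e : 𝓕 ≃ₜ f '' 𝓕 := hf.homeomorphImage 𝓕
  have he : (e ⁻¹' ((↑) ⁻¹' hitSet G) : Set 𝓕) = (↑) ⁻¹' hitSet ((↑) ⁻¹' G : Set X) := by
    ext D
    change ((↑) '' ((D : Compacts X) : Set X) ∩ G).Nonempty ↔ _
    rw [image_inter_nonempty_iff]
    rfl
  unfold IsMeagerIn
  rw [← he]
  refine ⟨fun h => ?_, fun h => h.preimage_of_isOpenMap e.continuous e.isOpenMap⟩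
  have := h.preimage_of_isOpenMap e.symm.continuous e.symm.isOpenMap
  rwa [← preimage_comp, e.self_comp_symm, preimage_id] at this

end Representation

theorem theorem1 {E : Type*} [TopologicalSpace E] [CompactSpace E] [PolishSpace E]
    (I : Set (Compacts E)) (hI : IsCompactIdeal I) (hGδ : IsGδ I) (hstar : HasPropertyStar I) :
    (∃ 𝓕 : Set (Compacts E), IsCompact 𝓕 ∧
      ∀ G : Set E, IsGδ G → (IsCountablyCovered I G ↔ IsMeagerIn (hitSet G) 𝓕)) ∧
    ((∀ K ∈ I, IsMeagre (K : Set E)) →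
      ∃ 𝓕 : Set (Compacts E), IsCompact 𝓕 ∧ IsUpwardClosed 𝓕 ∧
        ∀ G : Set E, IsGδ G → (IsCountablyCovered I G ↔ IsMeagerIn (hitSet G) 𝓕)) :=
  ⟨exists_representation hI hGδ hstar, exists_upwardClosed_representation hI hGδ hstar⟩
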